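/- Let $K$ be a finite simplicial complex (a finite collection of nonempty finite sets, closed under passing to nonempty subsets) whose vertices are totally ordered, and let $\mathbb F$ be a field. Let $f\colon K\to\mathbb R$ be a generalized discrete Morse function: $f(\sigma)\le f(\tau)$ whenever $\sigma\subseteq\tau$, and there is a (necessarily unique) partition $\hat V$ of $K$ into intervals $[\rho,\phi]=\{\psi\in K\mid \rho\subseteq\psi\subseteq\phi\}$, with $\rho\subseteq\phi$ in $K$, such that simplices $\sigma\subseteq\tau$ satisfy $f(\sigma)=f(\tau)$ if and only if they lie in a common interval of $\hat V$. A simplex $\sigma$ is critical if $\{\sigma\}\in\hat V$. Let $\le_{\hat V}$ be the transitive closure of the relation on $\hat V$ given by $I\sim J$ if some $\sigma\in I$ is a face of some $\tau\in J$. For $r\in\mathbb R$, the descending complex of $f$ at scale $r$ is the subcomplex $$D_r(f)=\bigcup\,\{I\in\hat V\mid I\le_{\hat V}\{\sigma\}\text{ for some critical }\sigma\in K\text{ with }f(\sigma)\le r\}.$$ The $f$-lexicographic order on $K$ orders the simplices by their value under $f$, then by dimension, then by the lexicographic order induced by the vertex order; here two simplices of the same dimension may be compared by either one of the two usual conventions,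 fixed once and for all, that is, lexicographically by their increasingly sorted vertex sequences or lexicographically by their decreasingly sorted vertex sequences. Let $C_n$ denote simplicial $n$-chains with coefficients in $\mathbb F$, with the basis of $n$-simplices oriented by the vertex order. For $n$-chains write $c_1\sqsubset c_2$ if the supports of $c_1$ and $c_2$ (the sets of $n$-simplices with nonzero coefficient) differ and the maximal simplex, in the $f$-lexicographic order, of their symmetric difference belongs to the support of $c_2$. A chain $c$ of degree $n$ in a complex is lexicographically minimal if there is no $(n+1)$-chain $e$ of that complex with $c+\partial e\sqsubset c$. Let $r\in\mathbb R$, let $K_r=f^{-1}(-\infty,r]$ be the sublevel complex, let $n\ge 0$, and let $h\in H_n(K_r;\mathbb F)$. Then $h$ has exactly one representative cycle in $C_n(K_r)$ that is lexicographically minimal in $K_r$, and every simplex in the support of this cycle belongs to $D_r(f)$. -/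

import Mathlib

namespace LexMorse

/-! ### Simplicial chains and homology over a field

A finite simplicial complex is a `PreAbstractSimplicialComplex` (a collection of nonempty finite
sets closed under passing to nonempty subsets) with finitely many faces. The vertices are totally
ordered and every simplex is oriented by that order. -/

section Homology

variable {ι : Type*} [LinearOrder ι]

/-- The `n`-dimensional simplices of `K`. -/
abbrev Simplex (K : PreAbstractSimplicialComplex ι) (n : ℕ) : Type _ :=
  {σ : Finset ι // σ ∈ K ∧ σ.card = n + 1}

/-- The space `C_n(K)` of simplicial `n`-chains with coefficients in `F`; its canonical basis is
the set of `n`-simplices. -/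
abbrev Chain (F : Type*) [Field F] (K : PreAbstractSimplicialComplex ι) (n : ℕ) : Type _ :=
  Simplex K n →₀ F

/-- The facet of an `(n+1)`-simplex that is opposite to the vertex `v`. -/
def Simplex.facet {K : PreAbstractSimplicialComplex ι} {n : ℕ} (σ : Simplex K (n + 1))
    (v : {v // v ∈ σ.1}) : Simplex K n :=
  ⟨σ.1.erase v.1, by
    have hcard : (σ.1.erase v.1).card = n + 1 := by
      rw [Finset.card_erase_of_mem v.2, σ.2.2]; rfl
    exact ⟨(K.isRelLowerSet_faces σ.2.1).2 (Finset.erase_subset _ _)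
      (Finset.card_pos.mp (by omega)), hcard⟩⟩

/-- The sign `(-1)^i`, where `v` is the `i`-th vertex of `σ` (counted from `0`). -/
def facetSign (F : Type*) [Field F] (σ : Finset ι) (v : ι) : F :=
  (-1) ^ (σ.filter (· < v)).card

/-- The simplicial boundary map
`∂ [v₀ < ⋯ < v_{n+1}] = ∑ i, (-1)^i [v₀, …, v̂ᵢ, …, v_{n+1}]`. -/
noncomputable def boundary (F : Type*) [Field F] (K : PreAbstractSimplicialComplex ι) (n : ℕ) :
    Chain F K (n + 1) →ₗ[F] Chain F K n :=
  Finsupp.linearCombination F fun σ : Simplex K (n + 1) =>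
    ∑ v ∈ σ.1.attach, Finsupp.single (σ.facet v) (facetSign F σ.1 v.1)

/-- The subspace of `n`-cycles; every `0`-chain is a cycle. -/
noncomputable def cycles (F : Type*) [Field F] (K : PreAbstractSimplicialComplex ι) :
    (n : ℕ) → Submodule F (Chain F K n)
  | 0 => ⊤
  | n + 1 => LinearMap.ker (boundary F K n)

/-- The subspace of `n`-boundaries. -/
noncomputable def boundaries (F : Type*) [Field F] (K : PreAbstractSimplicialComplex ι) (n : ℕ) :
    Submodule F (Chain F K n) :=
  LinearMap.range (boundary F K n)

/-- The quotient `Z / B` of subspaces `B ≤ Z` of a vector space. -/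
abbrev Subquotient {F M : Type*} [Field F] [AddCommGroup M] [Module F M]
    (Z B : Submodule F M) : Type _ :=
  Z ⧸ B.submoduleOf Z

/-- The class in `Z / B` of an element of `Z`. -/
def Subquotient.mk {F M : Type*} [Field F] [AddCommGroup M] [Module F M]
    {Z B : Submodule F M} (z : Z) : Subquotient Z B :=
  Submodule.Quotient.mk z

theorem Subquotient.mk_eq_mk_iff {F M : Type*} [Field F] [AddCommGroup M] [Module F M]
    {Z B : Submodule F M} (z z' : Z) :
    (Subquotient.mk z : Subquotient Z B) = Subquotient.mk z' ↔ z.1 - z'.1 ∈ B :=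
  Submodule.Quotient.eq _

theorem Subquotient.mk_surjective {F M : Type*} [Field F] [AddCommGroup M] [Module F M]
    {Z B : Submodule F M} (h : Subquotient Z B) : ∃ z : Z, Subquotient.mk z = h :=
  Submodule.Quotient.mk_surjective _ h

/-- Simplicial homology `H_n(K; F) = Z_n / B_n`. -/
def Homology (F : Type*) [Field F] (K : PreAbstractSimplicialComplex ι) (n : ℕ) : Type _ :=
  Subquotient (cycles F K n) (boundaries F K n)

/-- The homology class of a cycle. -/
noncomputable def homologyClass {F : Type*} [Field F] {K : PreAbstractSimplicialComplex ι} {n : ℕ}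
    (z : cycles F K n) : Homology F K n :=
  Subquotient.mk (Z := cycles F K n) (B := boundaries F K n) z

theorem facetSign_mul (F : Type*) [Field F] (σ : Finset ι) {v w : ι} (hv : v ∈ σ)
    (hvw : v < w) :
    facetSign F σ v * facetSign F (σ.erase v) w
      + facetSign F σ w * facetSign F (σ.erase w) v = 0 := by
  have h1 : ((σ.erase v).filter (· < w)) = (σ.filter (· < w)).erase v := by
    ext u; simp only [Finset.mem_filter, Finset.mem_erase]; tauto
  have h2 : ((σ.erase w).filter (· < v)) = σ.filter (· < v) := by
    ext u; simp only [Finset.mem_filter, Finset.mem_erase]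
    exact ⟨fun h => ⟨h.1.2, h.2⟩, fun h => ⟨⟨(h.2.trans hvw).ne, h.1⟩, h.2⟩⟩
  have hmem : v ∈ σ.filter (· < w) := Finset.mem_filter.mpr ⟨hv, hvw⟩
  unfold facetSign
  rw [h1, h2, ← Finset.card_erase_add_one hmem]
  ring

theorem boundary_single {F : Type*} [Field F] {K : PreAbstractSimplicialComplex ι} {n : ℕ}
    (σ : Simplex K (n + 1)) (a : F) :
    boundary F K n (Finsupp.single σ a)
      = ∑ v ∈ σ.1.attach, Finsupp.single (σ.facet v) (a * facetSign F σ.1 v.1) := by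
  simp [boundary, Finset.smul_sum]

/-- `∂ ∘ ∂ = 0`. -/
theorem boundary_boundary {F : Type*} [Field F] {K : PreAbstractSimplicialComplex ι} {n : ℕ}
    (c : Chain F K (n + 2)) : boundary F K n (boundary F K (n + 1) c) = 0 := by
  induction c using Finsupp.induction_linear with
  | zero => simp
  | add c d hc hd => simp [hc, hd]
  | single σ a =>
    rw [boundary_single, map_sum]
    simp only [boundary_single]
    rw [Finset.sum_sigma']
    refine Finset.sum_involution
      (fun x _ => ⟨⟨x.2.1, Finset.mem_of_mem_erase x.2.2⟩,
        ⟨x.1.1, Finset.mem_erase.mpr ⟨(Finset.ne_of_mem_erase x.2.2).symm, x.1.2⟩⟩⟩)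
      ?_ ?_ ?_ ?_
    · rintro ⟨⟨v, hv⟩, ⟨w, hw⟩⟩ -
      have hw' : w ≠ v ∧ w ∈ σ.1 := Finset.mem_erase.mp hw
      have hf : (σ.facet ⟨v, hv⟩).facet ⟨w, hw⟩ = (σ.facet ⟨w, hw'.2⟩).facet
          ⟨v, Finset.mem_erase.mpr ⟨hw'.1.symm, hv⟩⟩ := by
        apply Subtype.ext
        exact Finset.erase_right_comm
      dsimp only
      rw [hf, ← Finsupp.single_add, Finsupp.single_eq_zero]
      have key : facetSign F σ.1 v * facetSign F (σ.1.erase v) w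
          + facetSign F σ.1 w * facetSign F (σ.1.erase w) v = 0 := by
        rcases lt_or_gt_of_ne hw'.1 with h | h
        · rw [add_comm]; exact facetSign_mul F σ.1 hw'.2 h
        · exact facetSign_mul F σ.1 hv h
      change a * facetSign F σ.1 v * facetSign F (σ.1.erase v) w
          + a * facetSign F σ.1 w * facetSign F (σ.1.erase w) v = 0
      linear_combination a * key
    · rintro ⟨⟨v, hv⟩, ⟨w, hw⟩⟩ - - h
      have : w = v := congrArg (fun x => x.1.1) h
      exact (Finset.ne_of_mem_erase hw) this
    · intro x _
      simp
    · intro x _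
      rfl

theorem boundaries_le_cycles {F : Type*} [Field F] {K : PreAbstractSimplicialComplex ι} {n : ℕ} :
    boundaries F K n ≤ cycles F K n := by
  rintro _ ⟨c, rfl⟩
  cases n with
  | zero => exact Submodule.mem_top
  | succ n => exact boundary_boundary c

theorem homologyClass_eq_iff {F : Type*} [Field F] {K : PreAbstractSimplicialComplex ι} {n : ℕ}
    (z z' : cycles F K n) :
    homologyClass z = homologyClass z' ↔ ∃ e, z'.1 + boundary F K n e = z.1 := by
  refine (Subquotient.mk_eq_mk_iff z z').trans ?_
  constructor
  · rintro ⟨e, he⟩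
    exact ⟨e, by rw [he]; simp⟩
  · rintro ⟨e, he⟩
    exact ⟨e, by rw [← he]; simp⟩

theorem homologyClass_surjective {F : Type*} [Field F] {K : PreAbstractSimplicialComplex ι}
    {n : ℕ} (h : Homology F K n) : ∃ z : cycles F K n, homologyClass z = h :=
  Subquotient.mk_surjective h

end Homology

/-! ### Lexicographic orders -/

/-- The strict lexicographic order on the finite subsets of a set `X` that is totally ordered by
the strict order `lt`: the sets differ, and the maximal element of the symmetric difference of `A`
and `B` belongs to `B`. -/
def SetLexLT {X : Type*} (lt : X → X → Prop) (A B : Finset X) : Prop :=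
  ∃ m, m ∈ B ∧ m ∉ A ∧ ∀ x, x ≠ m → (x ∈ A ∧ x ∉ B ∨ x ∈ B ∧ x ∉ A) → lt x m

section Orders

variable {ι : Type*} [LinearOrder ι]

/-- The lexicographic order on vertex sets of equal size, read off the increasingly sorted vertex
sequences: the smallest vertex that lies in exactly one of `s` and `t` belongs to `s`. -/
def VertexLexLT (s t : Finset ι) : Prop := SetLexLT (· > ·) t s

/-- The lexicographic order on vertex sets of equal size, read off the decreasingly sorted vertex
sequences: the largest vertex that lies in exactly one of `s` and `t` belongs to `t`. -/
def VertexLexLT' (s t : Finset ι) : Prop := SetLexLT (· < ·) s t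

/-- The (strict) `f`-lexicographic order on simplices: by the value of `f`, then by dimension,
then by the lexicographic order `lexLT` on vertex sets. -/
def FLexLT (lexLT : Finset ι → Finset ι → Prop) (f : Finset ι → ℝ) (s t : Finset ι) : Prop :=
  f s < f t ∨ (f s = f t ∧ (s.card < t.card ∨ (s.card = t.card ∧ lexLT s t)))

/-- The strict lexicographic preorder on `n`-chains, with respect to a strict total order on
simplices: the lexicographic comparison of the supports. -/
def ChainLexLT {F : Type*} [Field F] {K : PreAbstractSimplicialComplex ι} {n : ℕ}
    (lt : Finset ι → Finset ι → Prop) (c₁ c₂ : Chain F K n) : Prop :=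
  SetLexLT (fun σ τ : Simplex K n => lt σ.1 τ.1) c₁.support c₂.support

/-- A chain is lexicographically minimal if no homologous chain `c + ∂ e` is strictly smaller. -/
def IsLexMinimal {F : Type*} [Field F] {K : PreAbstractSimplicialComplex ι} {n : ℕ}
    (lt : Finset ι → Finset ι → Prop) (c : Chain F K n) : Prop :=
  ¬ ∃ e : Chain F K (n + 1), ChainLexLT lt (c + boundary F K n e) c

end Orders

/-! ### Generalized discrete Morse functions and descending complexes

A function on the simplices of `K` is given as a function on all finite vertex sets; only its
values on the simplices of `K` matter. -/

section Morse

variable {ι : Type*} {K : PreAbstractSimplicialComplex ι} {f : Finset ι → ℝ}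

/-- `P` is a partition of `K` into intervals of the face poset such that simplices `σ ⊆ τ` of `K`
have the same value under `f` if and only if they lie in a common interval. -/
structure IsGradientPartition (K : PreAbstractSimplicialComplex ι) (f : Finset ι → ℝ)
    (P : Set (Set (Finset ι))) : Prop where
  interval : ∀ I ∈ P, ∃ ρ ∈ K, ∃ φ ∈ K, ρ ⊆ φ ∧ I = {ψ | ψ ∈ K ∧ ρ ⊆ ψ ∧ ψ ⊆ φ}
  partition : ∀ σ ∈ K, ∃! I, I ∈ P ∧ σ ∈ I
  eq_iff : ∀ σ ∈ K, ∀ τ ∈ K, σ ⊆ τ → (f σ = f τ ↔ ∃ I ∈ P, σ ∈ I ∧ τ ∈ I)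

/-- Generalized discrete Morse functions on `K`. -/
structure IsGeneralizedDiscreteMorse (K : PreAbstractSimplicialComplex ι)
    (f : Finset ι → ℝ) : Prop where
  mono : ∀ σ ∈ K, ∀ τ ∈ K, σ ⊆ τ → f σ ≤ f τ
  exists_partition : ∃ P, IsGradientPartition K f P

theorem IsGradientPartition.subset {P Q : Set (Set (Finset ι))} (hP : IsGradientPartition K f P)
    (hQ : IsGradientPartition K f Q) : P ⊆ Q := by
  have aux : ∀ {P Q : Set (Set (Finset ι))}, IsGradientPartition K f P →
      IsGradientPartition K f Q → ∀ I ∈ P, ∀ J ∈ Q, ∀ σ ∈ I, σ ∈ J → I ⊆ J := by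
    intro P Q hP hQ I hI J hJ σ hσI hσJ
    obtain ⟨ρ, hρ, φ, -, hρφ, rfl⟩ := hP.interval I hI
    have hρI : ρ ∈ {ψ | ψ ∈ K ∧ ρ ⊆ ψ ∧ ψ ⊆ φ} := ⟨hρ, Finset.Subset.refl _, hρφ⟩
    have key : ∀ τ, τ ∈ {ψ | ψ ∈ K ∧ ρ ⊆ ψ ∧ ψ ⊆ φ} → ∃ J' ∈ Q, ρ ∈ J' ∧ τ ∈ J' := fun τ hτ =>
      (hQ.eq_iff ρ hρ τ hτ.1 hτ.2.1).1 ((hP.eq_iff ρ hρ τ hτ.1 hτ.2.1).2 ⟨_, hI, hρI, hτ⟩)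
    obtain ⟨J₁, hJ₁, hρ₁, hσ₁⟩ := key σ hσI
    have e₁ : J₁ = J := (hQ.partition σ hσI.1).unique ⟨hJ₁, hσ₁⟩ ⟨hJ, hσJ⟩
    intro τ hτ
    obtain ⟨J₂, hJ₂, hρ₂, hτ₂⟩ := key τ hτ
    have e₂ : J₂ = J₁ := (hQ.partition ρ hρ).unique ⟨hJ₂, hρ₂⟩ ⟨hJ₁, hρ₁⟩
    rw [← e₁, ← e₂]; exact hτ₂
  intro I hI
  obtain ⟨ρ, hρ, φ, -, hρφ, hIeq⟩ := hP.interval I hI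
  have hρI : ρ ∈ I := by rw [hIeq]; exact ⟨hρ, Finset.Subset.refl _, hρφ⟩
  obtain ⟨J, ⟨hJ, hρJ⟩, -⟩ := hQ.partition ρ hρ
  have : I = J := Set.Subset.antisymm (aux hP hQ I hI J hJ ρ hρI hρJ)
    (aux hQ hP J hJ I hI ρ hρJ hρI)
  rw [this]; exact hJ

/-- The gradient partition is unique. -/
theorem IsGradientPartition.unique {P Q : Set (Set (Finset ι))} (hP : IsGradientPartition K f P)
    (hQ : IsGradientPartition K f Q) : P = Q :=
  Set.Subset.antisymm (hP.subset hQ) (hQ.subset hP)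

/-- The gradient partition of a generalized discrete Morse function. -/
def IsGeneralizedDiscreteMorse.gradientPartition (hf : IsGeneralizedDiscreteMorse K f) :
    Set (Set (Finset ι)) :=
  Classical.choose hf.exists_partition

theorem IsGeneralizedDiscreteMorse.isGradientPartition (hf : IsGeneralizedDiscreteMorse K f) :
    IsGradientPartition K f hf.gradientPartition :=
  Classical.choose_spec hf.exists_partition

/-- The sublevel complex `f⁻¹(-∞, r]`. -/
def sublevel (hf : IsGeneralizedDiscreteMorse K f) (r : ℝ) : PreAbstractSimplicialComplex ι where
  faces := {σ | σ ∈ K ∧ f σ ≤ r}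
  isRelLowerSet_faces := by
    rintro σ ⟨hσ, hr⟩
    refine ⟨(K.isRelLowerSet_faces hσ).1, fun ρ hρσ hρ => ?_⟩
    have hρK : ρ ∈ K := (K.isRelLowerSet_faces hσ).2 hρσ hρ
    exact ⟨hρK, (hf.mono ρ hρK σ hσ hρσ).trans hr⟩

/-- A simplex is critical if it forms a singleton interval of the gradient partition `P`. -/
def IsCritical (P : Set (Set (Finset ι))) (σ : Finset ι) : Prop := {σ} ∈ P

/-- The canonical partial order on the gradient partition `P`: the transitive closure of the
relation "some simplex of `I` is a face of some simplex of `J`". -/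
def IntervalLE (P : Set (Set (Finset ι))) : Set (Finset ι) → Set (Finset ι) → Prop :=
  Relation.TransGen fun I J => I ∈ P ∧ J ∈ P ∧ ∃ σ ∈ I, ∃ τ ∈ J, σ ⊆ τ

/-- The descending complex of `f` at scale `r`: the union of the intervals in the down set of the
critical intervals `{σ}` with `f σ ≤ r`. -/
def descendingComplex (hf : IsGeneralizedDiscreteMorse K f) (r : ℝ) :
    PreAbstractSimplicialComplex ι where
  faces := {τ | ∃ I ∈ hf.gradientPartition, τ ∈ I ∧
    ∃ σ, IsCritical hf.gradientPartition σ ∧ f σ ≤ r ∧ IntervalLE hf.gradientPartition I {σ}}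
  isRelLowerSet_faces := by
    rintro τ ⟨I, hI, hτI, σ, hσ, hr, hle⟩
    have hτK : τ ∈ K := by
      obtain ⟨ρ, -, φ, -, -, hIeq⟩ := hf.isGradientPartition.interval I hI
      rw [hIeq] at hτI
      exact hτI.1
    refine ⟨(K.isRelLowerSet_faces hτK).1, fun ρ hρτ hρ => ?_⟩
    have hρK : ρ ∈ K := (K.isRelLowerSet_faces hτK).2 hρτ hρ
    obtain ⟨J, ⟨hJ, hρJ⟩, -⟩ := hf.isGradientPartition.partition ρ hρK
    exact ⟨J, hJ, hρJ, σ, hσ, hr, Relation.TransGen.head ⟨hJ, hI, ρ, hρJ, τ, hτI, hρτ⟩ hle⟩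

end Morse

end LexMorse

/-!
Fix a field `F`, a finite totally ordered set `X` and a subspace `B` of the free vector space on
`X`. Every coset of `B` has exactly one element whose support is lexicographically minimal: the
comparison of supports is a strict order on a finite set, so minimal elements exist, and a minimal
element vanishes at the leading element of each nonzero `b ∈ B`, since otherwise a multiple of `b`
cancels that coefficient and changes only smaller ones (`apply_leading_eq_zero`). If two minimal
elements of a coset were different, both would vanish at the leading element of their difference,
which is absurd (`minimal_eq_of_sub_mem`). Applied to `B = B_n(K_r)`, this is existence and
uniqueness of the minimal cycle.

For the support of a minimal cycle `z`, let `[ρ, φ]` be a non-critical interval and let `v` be the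
least vertex of `φ \ ρ`; adding and removing `v` pairs the simplices of the interval. A simplex `τ`
of `[ρ, φ]` that does not contain `v` is the maximal facet of `τ ∪ {v}`, for both conventions on
lexicographic orders, so it is the leading simplex of a boundary and `z` vanishes at it
(`mem_of_isLexMinimal`). Hence the support of `z` consists of critical simplices, which lie in the
descending complex, and of simplices `τ` that contain the vertex `v` of their interval. Suppose some
of the latter are not in the descending complex, and choose such a `τ` with `f τ` maximal. As
`∂ z = 0`, the facet `τ \ {v}` lies in another simplex `τ'` of the support. The descending complex
does not contain `τ'`, for it is a subcomplex and a union of intervals and would contain `τ \ {v}`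
and then `τ`. So `f τ' ≤ f τ = f (τ \ {v}) ≤ f τ'`, and `τ'` is in the interval of `τ`. But then
`v ∈ τ'`, which forces `τ' = τ`.
-/

namespace LexMorse

/-! ### Lexicographic comparison of supports -/

section SetLex

variable {X : Type*} {lt : X → X → Prop}

theorem setLexLT_iff_toColex_lt [LinearOrder X] (A B : Finset X) :
    SetLexLT (· < ·) A B ↔ toColex A < toColex B := by
  rw [Finset.Colex.toColex_lt_toColex_iff_max'_mem]
  constructor
  · rintro ⟨m, hB, hA, h⟩
    have hne : A ≠ B := fun e => hA (e ▸ hB)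
    refine ⟨hne, ?_⟩
    have hmem : m ∈ symmDiff A B := Finset.mem_symmDiff.2 (Or.inr ⟨hB, hA⟩)
    have hmax := (symmDiff A B).max'_mem ⟨m, hmem⟩
    by_cases e : (symmDiff A B).max' ⟨m, hmem⟩ = m
    · rw [e]; exact hB
    · exact absurd (h _ e (Finset.mem_symmDiff.1 hmax)) (Finset.le_max' _ _ hmem).not_gt
  · rintro ⟨hne, h⟩
    have hn : (symmDiff A B).Nonempty := Finset.symmDiff_nonempty.2 hne
    have hmax := Finset.mem_symmDiff.1 ((symmDiff A B).max'_mem hn)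
    refine ⟨(symmDiff A B).max' hn, h, fun hA => ?_, fun x hx hd =>
      lt_of_le_of_ne (Finset.le_max' _ _ (Finset.mem_symmDiff.2 hd)) hx⟩
    rcases hmax with hm | hm
    · exact hm.2 h
    · exact hm.2 hA

open Classical in
instance setLexLT_isStrictTotalOrder [IsStrictTotalOrder X lt] :
    IsStrictTotalOrder (Finset X) (SetLexLT lt) := by
  let := linearOrderOfSTO lt
  have h : ∀ A B : Finset X, SetLexLT lt A B ↔ toColex A < toColex B := setLexLT_iff_toColex_lt
  exact
    { irrefl := fun A hA => lt_irrefl _ ((h A A).1 hA)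
      trans := fun A B C hAB hBC => (h A C).2 (((h A B).1 hAB).trans ((h B C).1 hBC))
      trichotomous := fun A B hAB hBA => by
        rw [h] at hAB hBA
        exact toColex.injective (le_antisymm (not_lt.1 hBA) (not_lt.1 hAB)) }

variable {F : Type*} [Field F] {B : Submodule F (X →₀ F)} {c c' : X →₀ F}

/-- A minimal element of a coset of `B` vanishes at the leading element `m` of any `b ∈ B`. -/
theorem apply_leading_eq_zero (hc : ∀ b ∈ B, ¬ SetLexLT lt (c + b).support c.support)
    {b : X →₀ F} (hb : b ∈ B) {m : X} (hm : b m ≠ 0)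
    (hlead : ∀ x, b x ≠ 0 → x ≠ m → lt x m) : c m = 0 := by
  by_contra hcm
  -- This multiple of `b` cancels the coefficient at `m` and changes only smaller ones.
  refine hc (-(c m / b m) • b) (B.smul_mem _ hb) ⟨m, by simpa using hcm, ?_, ?_⟩
  · simp [hm]
  · intro x hx hd
    refine hlead x (fun h0 => ?_) hx
    simp [h0] at hd

theorem minimal_eq_of_sub_mem [IsStrictTotalOrder X lt]
    (hc : ∀ b ∈ B, ¬ SetLexLT lt (c + b).support c.support)
    (hc' : ∀ b ∈ B, ¬ SetLexLT lt (c' + b).support c'.support) (h : c - c' ∈ B) : c = c' := by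
  classical
  let := linearOrderOfSTO lt
  by_contra hne
  have hn : (c - c').support.Nonempty := Finsupp.support_nonempty_iff.2 (sub_ne_zero.2 hne)
  have hm := Finsupp.mem_support_iff.1 ((c - c').support.max'_mem hn)
  have hlead : ∀ x, (c - c') x ≠ 0 → x ≠ (c - c').support.max' hn →
      lt x ((c - c').support.max' hn) := fun x hx hne =>
    lt_of_le_of_ne (Finset.le_max' _ _ (Finsupp.mem_support_iff.2 hx)) hne
  apply hm
  rw [Finsupp.sub_apply, apply_leading_eq_zero hc h hm hlead, apply_leading_eq_zero hc' h hm hlead,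
    sub_zero]

theorem exists_minimal_sub_mem [IsStrictTotalOrder X lt] [Finite X] (B : Submodule F (X →₀ F))
    (c : X →₀ F) :
    ∃ c', c' - c ∈ B ∧ ∀ b ∈ B, ¬ SetLexLT lt (c' + b).support c'.support := by
  have wf : WellFounded (SetLexLT lt) := Finite.wellFounded_of_trans_of_irrefl _
  obtain ⟨c', hc', hmin⟩ := (InvImage.wf (fun d : X →₀ F => d.support) wf).has_min
    {d | d - c ∈ B} ⟨c, by simp⟩
  refine ⟨c', hc', fun b hb => hmin (c' + b) ?_⟩
  rw [Set.mem_ofPred_eq, add_sub_right_comm]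
  exact B.add_mem hc' hb

end SetLex

/-! ### The `f`-lexicographic order -/

section Order

variable {ι : Type*} [LinearOrder ι] {lexLT : Finset ι → Finset ι → Prop}

theorem isStrictTotalOrder_of_vertexLex (hlex : lexLT = VertexLexLT ∨ lexLT = VertexLexLT') :
    IsStrictTotalOrder (Finset ι) lexLT := by
  rcases hlex with rfl | rfl
  · exact inferInstanceAs (IsStrictTotalOrder (Finset ι)
      (Function.swap (SetLexLT (X := ι) (· > ·))))
  · exact setLexLT_isStrictTotalOrder

instance fLexLT_isStrictTotalOrder [IsStrictTotalOrder (Finset ι) lexLT] (f : Finset ι → ℝ) :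
    IsStrictTotalOrder (Finset ι) (FLexLT lexLT f) where
  irrefl s h := by
    rcases h with h | ⟨-, h | ⟨-, h⟩⟩
    · exact lt_irrefl _ h
    · exact lt_irrefl _ h
    · exact irrefl_of lexLT s h
  trans s t u hst htu := by
    rcases hst with h | ⟨e, h⟩ <;> rcases htu with h' | ⟨e', h'⟩
    · exact Or.inl (h.trans h')
    · exact Or.inl (e' ▸ h)
    · exact Or.inl (e ▸ h')
    · refine Or.inr ⟨e.trans e', ?_⟩
      rcases h with h | ⟨e, h⟩ <;> rcases h' with h' | ⟨e', h'⟩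
      · exact Or.inl (h.trans h')
      · exact Or.inl (e' ▸ h)
      · exact Or.inl (e ▸ h')
      · exact Or.inr ⟨e.trans e', trans_of lexLT h h'⟩
  trichotomous s t hst hts := by
    unfold FLexLT at hst hts
    push Not at hst hts
    have e : f s = f t := le_antisymm hts.1 hst.1
    have h := hst.2 e
    have h' := hts.2 e.symm
    have e' : s.card = t.card := le_antisymm h'.1 h.1
    exact Std.Trichotomous.trichotomous (r := lexLT) s t (h.2 e') (h'.2 e'.symm)

instance simplex_isStrictTotalOrder {K : PreAbstractSimplicialComplex ι} {n : ℕ}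
    (lt : Finset ι → Finset ι → Prop) [IsStrictTotalOrder (Finset ι) lt] :
    IsStrictTotalOrder (Simplex K n) (fun σ τ => lt σ.1 τ.1) where
  irrefl σ := irrefl_of lt σ.1
  trans _ _ _ h h' := trans_of lt h h'
  trichotomous σ τ h h' := Subtype.ext (Std.Trichotomous.trichotomous (r := lt) σ.1 τ.1 h h')

/-- Removing the smaller of two vertices gives the larger facet, in either lexicographic order. -/
theorem lexLT_insert_erase (hlex : lexLT = VertexLexLT ∨ lexLT = VertexLexLT') {s : Finset ι}
    {v w : ι} (hv : v ∉ s) (hw : w ∈ s) (hvw : v < w) : lexLT ((insert v s).erase w) s := by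
  rcases hlex with rfl | rfl
  · refine ⟨v, by simp [hvw.ne], hv, fun x hx hd => ?_⟩
    have : x = w := by simp [hx] at hd; tauto
    exact this ▸ hvw
  · refine ⟨w, hw, by simp, fun x hx hd => ?_⟩
    have : x = v := by simp [hx] at hd; tauto
    exact this ▸ hvw

end Order

/-! ### Coefficients of boundaries -/

section Boundary

variable {ι : Type*} [LinearOrder ι] {F : Type*} [Field F] {K : PreAbstractSimplicialComplex ι}
  {n : ℕ}

theorem boundary_single_apply_facet (τ : Simplex K (n + 1)) (v : {v // v ∈ τ.1}) (a : F) :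
    boundary F K n (Finsupp.single τ a) (τ.facet v) = a * facetSign F τ.1 v.1 := by
  classical
  rw [boundary_single, Finsupp.finsetSum_apply, Finset.sum_eq_single v]
  · simp
  · intro w _ hw
    refine Finsupp.single_eq_of_ne fun h => hw (Subtype.ext ?_)
    exact ((Finset.erase_inj τ.1 v.2).1 (congrArg Subtype.val h)).symm
  · simp

theorem exists_facet_of_boundary_single_apply_ne_zero {τ : Simplex K (n + 1)} {σ : Simplex K n}
    {a : F} (h : boundary F K n (Finsupp.single τ a) σ ≠ 0) : ∃ v, τ.facet v = σ := by
  classical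
  rw [boundary_single, Finsupp.finsetSum_apply] at h
  obtain ⟨v, -, hv⟩ := Finset.exists_ne_zero_of_sum_ne_zero h
  by_contra hne
  push Not at hne
  exact hv (Finsupp.single_eq_of_ne (hne v).symm)

theorem facetSign_ne_zero (σ : Finset ι) (v : ι) : facetSign F σ v ≠ 0 :=
  pow_ne_zero _ (neg_ne_zero.2 one_ne_zero)

/-- A facet of a simplex in the support of a cycle is covered a second time. -/
theorem exists_ne_facet_subset {c : Chain F K (n + 1)} (hc : boundary F K n c = 0)
    {τ : Simplex K (n + 1)} (hτ : τ ∈ c.support) (v : {v // v ∈ τ.1}) :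
    ∃ τ' ∈ c.support, τ' ≠ τ ∧ (τ.facet v).1 ⊆ τ'.1 := by
  classical
  by_contra hne
  push Not at hne
  have h : boundary F K n c (τ.facet v) = c τ * facetSign F τ.1 v.1 := by
    conv_lhs => rw [← Finsupp.sum_single c, Finsupp.sum, map_sum]
    rw [Finsupp.finsetSum_apply, Finset.sum_eq_single_of_mem τ hτ]
    · exact boundary_single_apply_facet τ v _
    · intro τ' hτ' hne'
      by_contra h0
      obtain ⟨w, hw⟩ := exists_facet_of_boundary_single_apply_ne_zero h0
      refine hne τ' hτ' hne' ?_
      rw [← hw]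
      exact Finset.erase_subset _ _
  rw [hc, Finsupp.zero_apply] at h
  exact mul_ne_zero (Finsupp.mem_support_iff.1 hτ) (facetSign_ne_zero _ _) h.symm

end Boundary

/-! ### Intervals and the descending complex -/

section Intervals

variable {ι : Type*} {K : PreAbstractSimplicialComplex ι} {f : Finset ι → ℝ}

theorem IsGradientPartition.eq_of_mem {P : Set (Set (Finset ι))} (hP : IsGradientPartition K f P)
    {I J : Set (Finset ι)} (hI : I ∈ P) (hJ : J ∈ P) {σ : Finset ι} (hσ : σ ∈ K) (hσI : σ ∈ I)
    (hσJ : σ ∈ J) : I = J :=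
  (hP.partition σ hσ).unique ⟨hI, hσI⟩ ⟨hJ, hσJ⟩

theorem IsGradientPartition.mem_of_eq {P : Set (Set (Finset ι))} (hP : IsGradientPartition K f P)
    {I : Set (Finset ι)} (hI : I ∈ P) {σ τ : Finset ι} (hσ : σ ∈ K) (hτ : τ ∈ K) (h : σ ⊆ τ)
    (he : f σ = f τ) : σ ∈ I ↔ τ ∈ I := by
  obtain ⟨J, hJ, hσJ, hτJ⟩ := (hP.eq_iff σ hσ τ hτ h).1 he
  constructor
  · intro hσI
    rwa [hP.eq_of_mem hI hJ hσ hσI hσJ]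
  · intro hτI
    rwa [hP.eq_of_mem hI hJ hτ hτI hτJ]

theorem mem_descendingComplex_of_isCritical (hf : IsGeneralizedDiscreteMorse K f) {r : ℝ}
    {σ : Finset ι} (hσ : IsCritical hf.gradientPartition σ) (hr : f σ ≤ r) :
    σ ∈ descendingComplex hf r :=
  ⟨{σ}, hσ, rfl, σ, hσ, hr, Relation.TransGen.single ⟨hσ, hσ, σ, rfl, σ, rfl, subset_rfl⟩⟩

theorem mem_descendingComplex_of_mem_interval (hf : IsGeneralizedDiscreteMorse K f) {r : ℝ}
    {I : Set (Finset ι)} (hI : I ∈ hf.gradientPartition) {σ τ : Finset ι} (hσK : σ ∈ K)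
    (hσ : σ ∈ I) (hτ : τ ∈ I) (h : σ ∈ descendingComplex hf r) : τ ∈ descendingComplex hf r := by
  obtain ⟨J, hJ, hσJ, hJr⟩ := h
  have e := hf.isGradientPartition.eq_of_mem hI hJ hσK hσ hσJ
  exact ⟨J, hJ, e ▸ hτ, hJr⟩

end Intervals

/-! ### Minimal cycles -/

section MinimalCycles

variable {ι : Type*} [LinearOrder ι] {F : Type*} [Field F] {K : PreAbstractSimplicialComplex ι}
  {f : Finset ι → ℝ} {lexLT : Finset ι → Finset ι → Prop} {n : ℕ}

theorem isLexMinimal_iff {lt : Finset ι → Finset ι → Prop} {c : Chain F K n} :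
    IsLexMinimal lt c ↔ ∀ b ∈ boundaries F K n,
      ¬ SetLexLT (fun σ τ : Simplex K n => lt σ.1 τ.1) (c + b).support c.support := by
  simp [IsLexMinimal, ChainLexLT, boundaries]

/-- The simplices of an interval `[ρ, φ]` that lie in the support of a lexicographically minimal
chain contain the least vertex `v` of `φ \ ρ`. -/
theorem mem_of_isLexMinimal (hf : IsGeneralizedDiscreteMorse K f)
    (hlex : lexLT = VertexLexLT ∨ lexLT = VertexLexLT') {r : ℝ} {c : Chain F (sublevel hf r) n}
    (hc : IsLexMinimal (FLexLT lexLT f) c) {ρ φ : Finset ι} (hφ : φ ∈ K)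
    (hI : {ψ | ψ ∈ K ∧ ρ ⊆ ψ ∧ ψ ⊆ φ} ∈ hf.gradientPartition) {v : ι} (hvφ : v ∈ φ)
    (hv : ∀ w ∈ φ, w ∉ ρ → v ≤ w) {τ : Simplex (sublevel hf r) n} (hτ : τ ∈ c.support)
    (hρτ : ρ ⊆ τ.1) (hτφ : τ.1 ⊆ φ) : v ∈ τ.1 := by
  by_contra hvτ
  have hP := hf.isGradientPartition
  have hτK : τ.1 ∈ K := τ.2.1.1
  have hsub : insert v τ.1 ⊆ φ := Finset.insert_subset hvφ hτφ
  have hK : insert v τ.1 ∈ K := (K.isRelLowerSet_faces hφ).2 hsub (Finset.insert_nonempty _ _)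
  have hmem : insert v τ.1 ∈ {ψ | ψ ∈ K ∧ ρ ⊆ ψ ∧ ψ ⊆ φ} :=
    ⟨hK, hρτ.trans (Finset.subset_insert _ _), hsub⟩
  have hfe : f τ.1 = f (insert v τ.1) :=
    (hP.eq_iff _ hτK _ hK (Finset.subset_insert _ _)).2 ⟨_, hI, ⟨hτK, hρτ, hτφ⟩, hmem⟩
  let τ' : Simplex (sublevel hf r) (n + 1) :=
    ⟨insert v τ.1, ⟨hK, hfe ▸ τ.2.1.2⟩, by rw [Finset.card_insert_of_notMem hvτ, τ.2.2]⟩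
  have hfacet : τ'.facet ⟨v, Finset.mem_insert_self _ _⟩ = τ :=
    Subtype.ext (Finset.erase_insert hvτ)
  refine Finsupp.mem_support_iff.1 hτ (apply_leading_eq_zero (isLexMinimal_iff.1 hc)
    (b := boundary F _ n (Finsupp.single τ' 1)) ⟨_, rfl⟩ ?_ ?_)
  · conv in τ => rw [← hfacet]
    rw [boundary_single_apply_facet, one_mul]
    exact facetSign_ne_zero _ _
  -- A facet of `τ ∪ {v}` has a smaller value of `f` or the form `(τ ∪ {v}) \ {w}` with `v < w`.
  · intro x hx hne
    obtain ⟨⟨w, hw⟩, rfl⟩ := exists_facet_of_boundary_single_apply_ne_zero hx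
    have hwv : w ≠ v := by
      rintro rfl
      exact hne hfacet
    have hwτ : w ∈ τ.1 := Finset.mem_of_mem_insert_of_ne hw hwv
    have hxK : (insert v τ.1).erase w ∈ K := (τ'.facet ⟨w, hw⟩).2.1.1
    rcases (hf.mono _ hxK _ hK (Finset.erase_subset _ _)).lt_or_eq with hlt | heq
    · exact Or.inl (hfe ▸ hlt)
    · refine Or.inr ⟨heq.trans hfe.symm, Or.inr
        ⟨(τ'.facet ⟨w, hw⟩).2.2.trans τ.2.2.symm, lexLT_insert_erase hlex hvτ hwτ ?_⟩⟩
      have hρ : ρ ⊆ (insert v τ.1).erase w :=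
        ((hP.mem_of_eq hI hxK hK (Finset.erase_subset _ _) heq).2 hmem).2.1
      exact lt_of_le_of_ne
        (hv w (hτφ hwτ) fun hwρ => Finset.notMem_erase w _ (hρ hwρ)) hwv.symm

theorem support_subset_descendingComplex (hf : IsGeneralizedDiscreteMorse K f)
    (hlex : lexLT = VertexLexLT ∨ lexLT = VertexLexLT') {r : ℝ}
    (z : cycles F (sublevel hf r) n) (hz : IsLexMinimal (FLexLT lexLT f) z.1) :
    ∀ σ ∈ z.1.support, σ.1 ∈ descendingComplex hf r := by
  classical
  obtain ⟨c, hcyc⟩ := z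
  change IsLexMinimal (FLexLT lexLT f) c at hz
  change ∀ σ ∈ c.support, σ.1 ∈ descendingComplex hf r
  by_contra hex
  push Not at hex
  have hP := hf.isGradientPartition
  obtain ⟨τ, hτmem, hmax⟩ := Finset.exists_max_image
    (c.support.filter fun σ => σ.1 ∉ descendingComplex hf r) (fun σ => f σ.1)
    (by obtain ⟨σ, h⟩ := hex; exact ⟨σ, Finset.mem_filter.2 h⟩)
  obtain ⟨hτ, hτD⟩ := Finset.mem_filter.1 hτmem
  have hτK : τ.1 ∈ K := τ.2.1.1
  obtain ⟨I, ⟨hI, hτI⟩, -⟩ := hP.partition τ.1 hτK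
  obtain ⟨ρ, hρK, φ, hφK, hρφ, rfl⟩ := hP.interval I hI
  obtain ⟨-, hρτ, hτφ⟩ := hτI
  -- Otherwise the interval is `{τ}`, and the critical simplex `τ` is in the descending complex.
  have hne : (φ \ ρ).Nonempty := by
    rw [Finset.sdiff_nonempty]
    intro hφρ
    refine hτD (mem_descendingComplex_of_isCritical hf ?_ τ.2.1.2)
    have : ({τ.1} : Set (Finset ι)) = {ψ | ψ ∈ K ∧ ρ ⊆ ψ ∧ ψ ⊆ φ} := by
      ext ψ
      refine ⟨fun h => h ▸ ⟨hτK, hρτ, hτφ⟩, fun h => ?_⟩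
      exact Finset.Subset.antisymm (h.2.2.trans (hφρ.trans hρτ))
        (hτφ.trans (hφρ.trans h.2.1))
    rw [IsCritical, this]
    exact hI
  obtain ⟨v, hvmem, hvmin⟩ := Finset.exists_min_image (φ \ ρ) id hne
  obtain ⟨hvφ, hvρ⟩ := Finset.mem_sdiff.1 hvmem
  have hvle : ∀ w ∈ φ, w ∉ ρ → v ≤ w := fun w h h' => hvmin w (Finset.mem_sdiff.2 ⟨h, h'⟩)
  have hvτ : v ∈ τ.1 := mem_of_isLexMinimal hf hlex hz hφK hI hvφ hvle hτ hρτ hτφ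
  have hρe : ρ ⊆ τ.1.erase v := Finset.subset_erase.2 ⟨hρτ, hvρ⟩
  cases n with
  | zero =>
    -- A single vertex cannot contain both `v` and the nonempty set `ρ`.
    have h0 : (τ.1.erase v).card = 0 := by rw [Finset.card_erase_of_mem hvτ, τ.2.2]
    have h1 : 0 < ρ.card := Finset.card_pos.2 (K.isRelLowerSet_faces hρK).1
    have := Finset.card_le_card hρe
    omega
  | succ n =>
    obtain ⟨τ', hτ', hne', hsub⟩ := exists_ne_facet_subset hcyc hτ ⟨v, hvτ⟩
    change τ.1.erase v ⊆ τ'.1 at hsub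
    have hσK : τ.1.erase v ∈ K := (τ.facet ⟨v, hvτ⟩).2.1.1
    have hσI : τ.1.erase v ∈ {ψ | ψ ∈ K ∧ ρ ⊆ ψ ∧ ψ ⊆ φ} :=
      ⟨hσK, hρe, (Finset.erase_subset _ _).trans hτφ⟩
    have hτ'D : τ'.1 ∉ descendingComplex hf r := fun h =>
      hτD (mem_descendingComplex_of_mem_interval hf hI hσK hσI ⟨hτK, hρτ, hτφ⟩
        (((descendingComplex hf r).isRelLowerSet_faces h).2 hsub
          (K.isRelLowerSet_faces hσK).1))
    -- The choice of `τ` forces `τ'` into the interval of `τ`.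
    have hle : f τ'.1 ≤ f τ.1 := hmax τ' (Finset.mem_filter.2 ⟨hτ', hτ'D⟩)
    have hfe : f (τ.1.erase v) = f τ.1 :=
      (hP.eq_iff _ hσK _ hτK (Finset.erase_subset _ _)).2 ⟨_, hI, hσI, hτK, hρτ, hτφ⟩
    have hτ'K : τ'.1 ∈ K := τ'.2.1.1
    have hτ'I := (hP.mem_of_eq hI hσK hτ'K hsub
      (le_antisymm (hf.mono _ hσK _ hτ'K hsub) (hle.trans hfe.ge))).1 hσI
    have hvτ' : v ∈ τ'.1 :=
      mem_of_isLexMinimal hf hlex hz hφK hI hvφ hvle hτ' hτ'I.2.1 hτ'I.2.2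
    have hττ' : τ.1 ⊆ τ'.1 := by
      rw [← Finset.insert_erase hvτ]
      exact Finset.insert_subset hvτ' hsub
    exact hne' (Subtype.ext
      (Finset.eq_of_subset_of_card_le hττ' (τ'.2.2.trans τ.2.2.symm).le).symm)

theorem existsUnique_isLexMinimal [Finite (Simplex K n)] (lt : Finset ι → Finset ι → Prop)
    [IsStrictTotalOrder (Finset ι) lt] (h : Homology F K n) :
    ∃! z : cycles F K n, homologyClass z = h ∧ IsLexMinimal lt z.1 := by
  obtain ⟨z₀, rfl⟩ := homologyClass_surjective h
  obtain ⟨c, hcB, hmin⟩ := exists_minimal_sub_mem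
    (lt := fun σ τ : Simplex K n => lt σ.1 τ.1) (boundaries F K n) z₀.1
  have hc : c ∈ cycles F K n := by
    rw [← sub_add_cancel c z₀.1]
    exact add_mem (boundaries_le_cycles hcB) z₀.2
  refine ⟨⟨c, hc⟩, ⟨(Subquotient.mk_eq_mk_iff _ _).2 hcB, isLexMinimal_iff.2 hmin⟩, ?_⟩
  rintro z ⟨hz, hzmin⟩
  refine Subtype.ext (minimal_eq_of_sub_mem (isLexMinimal_iff.1 hzmin) hmin ?_)
  rw [← sub_sub_sub_cancel_right z.1 c z₀.1]
  exact sub_mem ((Subquotient.mk_eq_mk_iff _ _).1 hz) hcB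

end MinimalCycles

end LexMorse

theorem mainTheorem3 {ι : Type*} [LinearOrder ι] (F : Type*) [Field F]
    (K : PreAbstractSimplicialComplex ι) (hK : K.faces.Finite)
    (f : Finset ι → ℝ) (hf : LexMorse.IsGeneralizedDiscreteMorse K f)
    (lexLT : Finset ι → Finset ι → Prop)
    (hlex : lexLT = LexMorse.VertexLexLT ∨ lexLT = LexMorse.VertexLexLT')
    (r : ℝ) (n : ℕ) (h : LexMorse.Homology F (LexMorse.sublevel hf r) n) :
    (∃! z : LexMorse.cycles F (LexMorse.sublevel hf r) n,
      LexMorse.homologyClass z = h ∧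
        LexMorse.IsLexMinimal (LexMorse.FLexLT lexLT f) z.1) ∧
    ∀ z : LexMorse.cycles F (LexMorse.sublevel hf r) n,
      LexMorse.homologyClass z = h →
      LexMorse.IsLexMinimal (LexMorse.FLexLT lexLT f) z.1 →
      ∀ σ ∈ z.1.support, σ.1 ∈ LexMorse.descendingComplex hf r := by
  have := LexMorse.isStrictTotalOrder_of_vertexLex hlex
  have : Finite (LexMorse.Simplex (LexMorse.sublevel hf r) n) :=
    (hK.subset fun σ (hσ : σ ∈ LexMorse.sublevel hf r ∧ σ.card = n + 1) => hσ.1.1).to_subtype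
  exact ⟨LexMorse.existsUnique_isLexMinimal _ h,
    fun z _ hz => LexMorse.support_subset_descendingComplex hf hlex z hz⟩
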